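/- Let $\{\mathcal S_m\}_{m=1}^M$ be a partition of $\{1,\dots,J\}$ into $M\ge 2$ nonempty blocks, let $\lambda\ge 0$, and let $K$ be a $J\times J$ positive semidefinite matrix. For a random pair $(T,\mathbf X)$ with $\mathbf X=(X_1,\dots,X_J)$ real-valued, let $Y=X_1+\cdots+X_J+Z$ with $Z\sim\mathcal N(0,1)$ independent of $(T,\mathbf X)$ (so $T\leftrightarrow\mathbf X\leftrightarrow Y$ is a Markov chain), write $X_{\mathcal S}=(X_j)_{j\in\mathcal S}$, and put $$s_\lambda(\mathbf X|T)=(\lambda-1)\,I(\mathbf X;Y|T)-\frac{\lambda}{M-1}\sum_{m=1}^M I(X_{\mathcal S_m^c};Y|X_{\mathcal S_m},T).$$ Let $S_\lambda(\mathbf X)$ be the infimum of $s_\lambda(\mathbf X|T)$ over all $T$ jointly distributed with $\mathbf X$ in this way, for the given law of $\mathbf X$, and let $V_\lambda(K)$ be the infimum of $S_\lambda(\mathbf X)$ over all laws of $\mathbf X$ with finite second moments and $E[\mathbf X\mathbf X^T]=K$. A joint law of $(T,\mathbf X)$ attains $V_\lambda(K)$ if $E[\mathbf X\mathbf X^T]=K$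 and $s_\lambda(\mathbf X|T)=V_\lambda(K)$. Let $p_*(t,\mathbf x)$ attain $V_\lambda(K)$, with $E[\mathbf X]=0$ under $p_*$. Let $(T_1,\mathbf X_1)$, $(T_2,\mathbf X_2)$ have law $p_*$ and $Z_1,Z_2\sim\mathcal N(0,1)$, all four independent; let $Y_i$ be the sum of the entries of $\mathbf X_i$ plus $Z_i$ for $i=1,2$. Put $T=(T_1,T_2)$ and $$\mathbf X_{\theta_1}=\tfrac{1}{\sqrt2}(\mathbf X_1+\mathbf X_2),\quad \mathbf X_{\theta_2}=\tfrac{1}{\sqrt2}(\mathbf X_1-\mathbf X_2),\quad Y_{\theta_1}=\tfrac{1}{\sqrt2}(Y_1+Y_2),\quad Y_{\theta_2}=\tfrac{1}{\sqrt2}(Y_1-Y_2).$$ Then: 1. $(T,\mathbf X_{\theta_1})$ attains $V_\lambda(K)$. 2. $(T,\mathbf X_{\theta_2})$ attains $V_\lambda(K)$. 3. If $\lambda>0$, then for every $m=1,\dots,M$, $$I\big(Y_{\theta_1};[\mathbf X_{\theta_2}]_{\mathcal S_m}\,\big|\,[\mathbf X_{\theta_1}]_{\mathcal S_m},T\big)=0\quad\text{and}\quad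 I\big(Y_{\theta_2};[\mathbf X_{\theta_1}]_{\mathcal S_m}\,\big|\,Y_{\theta_1},[\mathbf X_{\theta_2}]_{\mathcal S_m},T\big)=0.$$ -/

import Mathlib

open MeasureTheory ProbabilityTheory InformationTheory

noncomputable section

namespace GMAC

/-- Conditional mutual information `I(A; B | C)` (in nats): the Kullback–Leibler divergence of the
joint law of `(C, (A, B))` from the law under which `A` and `B` keep their conditional laws
given `C` but are conditionally independent given `C`. -/
def condMutualInfo {Ω α β γ : Type*} [MeasurableSpace Ω]
    [MeasurableSpace α] [StandardBorelSpace α] [Nonempty α]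
    [MeasurableSpace β] [StandardBorelSpace β] [Nonempty β] [MeasurableSpace γ]
    (Pr : Measure Ω) [IsFiniteMeasure Pr] (A : Ω → α) (B : Ω → β) (C : Ω → γ) : ENNReal :=
  klDiv (Pr.map fun ω => (C ω, (A ω, B ω)))
    ((Pr.map C).compProd ((condDistrib A C Pr).prod (condDistrib B C Pr)))

variable {J : ℕ}

/-- The functional `s_λ(X | T)` for random variables `T`, `X = (X_1, …, X_J)` and `Y` on a
probability space and a partition `{S_m}` of the users into `M` blocks:
`(λ - 1) I(X; Y | T) - λ / (M - 1) ∑_m I(X_{S_m^c}; Y | X_{S_m}, T)`. -/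
def lagrangian {Ω τ : Type*} [MeasurableSpace Ω] [MeasurableSpace τ]
    (𝒮 : Finpartition (Finset.univ : Finset (Fin J))) (lam : ℝ)
    (Pr : Measure Ω) [IsFiniteMeasure Pr] (T : Ω → τ) (X : Ω → Fin J → ℝ) (Y : Ω → ℝ) : ℝ :=
  (lam - 1) * (condMutualInfo Pr X Y T).toReal
    - lam / ((𝒮.parts.card : ℝ) - 1) * ∑ S ∈ 𝒮.parts,
        (condMutualInfo Pr (fun ω => Sᶜ.restrict (X ω)) Y
          (fun ω => (S.restrict (X ω), T ω))).toReal

/-- `s_λ(X | T)` as a function of the joint law `μ` of `(T, X)`. The output is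
`Y = X_1 + ⋯ + X_J + Z` with `Z ∼ N(0, 1)` independent of `(T, X)`, so that
`T ↔ X ↔ Y` is a Markov chain. -/
def lowerS {τ : Type*} [MeasurableSpace τ]
    (𝒮 : Finpartition (Finset.univ : Finset (Fin J))) (lam : ℝ)
    (μ : Measure (τ × (Fin J → ℝ))) [IsProbabilityMeasure μ] : ℝ :=
  lagrangian 𝒮 lam (μ.prod (gaussianReal 0 1))
    (fun ω => ω.1.1) (fun ω => ω.1.2) (fun ω => (∑ j, ω.1.2 j) + ω.2)

/-- `S_λ(X)` as a function of the law `P` of `X`: the infimum of `s_λ(X | T)` over all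
joint laws of `(T, X)` whose `X`-marginal is `P`. -/
def upperS (𝒮 : Finpartition (Finset.univ : Finset (Fin J))) (lam : ℝ)
    (P : Measure (Fin J → ℝ)) : EReal :=
  ⨅ (τ : Type) (_ : MeasurableSpace τ) (μ : Measure (τ × (Fin J → ℝ)))
    (_ : IsProbabilityMeasure μ) (_ : μ.snd = P), (lowerS 𝒮 lam μ : EReal)

/-- `E[X Xᵀ] = K` for `X ∼ P`, including finiteness of the second moments. -/
def HasSecondMoment (P : Measure (Fin J → ℝ)) (K : Matrix (Fin J) (Fin J) ℝ) : Prop :=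
  (∀ i, MemLp (fun x : Fin J → ℝ => x i) 2 P) ∧ ∀ i j, ∫ x, x i * x j ∂P = K i j

/-- The dual function `V_λ(K)`: the infimum of `S_λ(X)` over all laws of `X` with
`E[X Xᵀ] = K`. -/
def dualValue (𝒮 : Finpartition (Finset.univ : Finset (Fin J))) (lam : ℝ)
    (K : Matrix (Fin J) (Fin J) ℝ) : EReal :=
  ⨅ (P : Measure (Fin J → ℝ)) (_ : IsProbabilityMeasure P) (_ : HasSecondMoment P K),
    upperS 𝒮 lam P

/-- The joint law `μ` of `(T, X)` attains `V_λ(K)`. -/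
def Attains {τ : Type} [MeasurableSpace τ]
    (𝒮 : Finpartition (Finset.univ : Finset (Fin J))) (lam : ℝ)
    (K : Matrix (Fin J) (Fin J) ℝ) (μ : Measure (τ × (Fin J → ℝ))) : Prop :=
  ∃ _ : IsProbabilityMeasure μ,
    HasSecondMoment μ.snd K ∧ (lowerS 𝒮 lam μ : EReal) = dualValue 𝒮 lam K

end GMAC

end

noncomputable section

namespace GMAC

/-! ### Kullback–Leibler divergence -/

section KL

variable {Ω α β γ δ : Type*} [MeasurableSpace Ω] [MeasurableSpace α] [MeasurableSpace β]
  [MeasurableSpace γ] [MeasurableSpace δ]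

/-! Measure everything by relative entropy from `N(0,1)`. If `(C, A)` carries the same information
as `(T, X)`, the chain rule gives `I(A; Y | C) = D(Y | C, A) - D(Y | C)`, and `D(Y | C, A) = E[(∑
X_j)²] / 2` depends on `K` alone (`IsChannel.toReal_condMutualInfo`). So `s_λ` is an affine
combination of the finite numbers `D(Y | T)` and `D(Y | X_S, T)`, and no differential entropies are
needed.

Do the same for two channel uses at once, relative to `N(0,1) ⊗ N(0,1)`. For independent copies of
an optimizer, this two-letter Lagrangian is `2 V`. It is unchanged when inputs and outputs are both
passed to normalized sums and differences: the reference measure is invariant, and each conditioning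
pair of blocks is transformed bijectively (`twoLetterLagrangian_sumDiff`).

Write `A, B` for the new inputs and `U, V` for the outputs. Expanding by the chain rule, `U` first
and then `V`, gives `2 V_λ = s_λ(A | T) + s_λ(B | U, T) + λ/(M-1) ∑_S [I(U; B_S | A_S, T) + I(V; A_S
| U, B_S, T)]`. The `λ - 1` term splits exactly, so its sign is irrelevant. Zero mean and
independence keep the second moment `K`, so both Lagrangians are at least `V_λ`, with `(U, T)` as an
admissible auxiliary variable for `B`. The information terms are nonnegative, so equality holds
throughout (`attains_of_twoLetterLagrangian_eq`). Exchanging the roles of `A` and `B` gives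
optimality of `B` given `T` alone. -/

theorem klDiv_map_of_leftInverse (μ ν : Measure α) [IsFiniteMeasure μ] [IsFiniteMeasure ν]
    {f : α → β} {g : β → α} (hf : Measurable f) (hg : Measurable g)
    (hgf : Function.LeftInverse g f) :
    klDiv (μ.map f) (ν.map f) = klDiv μ ν := by
  refine le_antisymm (klDiv_map_le μ ν hf) ?_
  have h := klDiv_map_le (μ.map f) (ν.map f) hg
  rwa [Measure.map_map hg hf, Measure.map_map hg hf, hgf.comp_eq_id, Measure.map_id,
    Measure.map_id] at h

theorem klDiv_prod_left (μ ν : Measure α) [IsFiniteMeasure μ] [IsFiniteMeasure ν]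
    (ρ : Measure β) [IsProbabilityMeasure ρ] :
    klDiv (μ.prod ρ) (ν.prod ρ) = klDiv μ ν := by
  rw [← Measure.compProd_const, ← Measure.compProd_const, klDiv_compProd_left]

theorem klDiv_prod (μ ν : Measure α) [IsProbabilityMeasure μ] [IsFiniteMeasure ν]
    (ρ σ : Measure β) [IsProbabilityMeasure ρ] [IsProbabilityMeasure σ] :
    klDiv (μ.prod ρ) (ν.prod σ) = klDiv μ ν + klDiv ρ σ := by
  have h := klDiv_compProd_eq_add μ ν (Kernel.const α ρ) (Kernel.const α σ)
  simp only [Measure.compProd_const] at h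
  rw [h, ← klDiv_map_of_leftInverse (μ.prod ρ) (μ.prod σ) measurable_swap measurable_swap
    Prod.swap_leftInverse, Measure.prod_swap, Measure.prod_swap, klDiv_prod_left]

/-- Relative entropy `D(P_{B|C} ‖ ν | P_C)` of the conditional law of `B` given `C` from the fixed
measure `ν`. -/
def condRelEntropy (P : Measure Ω) (ν : Measure β) (C : Ω → γ) (B : Ω → β) : ENNReal :=
  klDiv (P.map fun ω => (C ω, B ω)) ((P.map C).prod ν)

variable (P : Measure Ω) [IsProbabilityMeasure P] (ν : Measure β) [IsProbabilityMeasure ν]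

/-- Only the information in the conditioning variable matters. Used both to reorder tuples and to
rotate blocks of inputs. -/
theorem condRelEntropy_comp_left {C : Ω → γ} {B : Ω → β} (hC : Measurable C) (hB : Measurable B)
    {f : γ → δ} {g : δ → γ} (hf : Measurable f) (hg : Measurable g)
    (hgf : Function.LeftInverse g f) :
    condRelEntropy P ν (fun ω => f (C ω)) B = condRelEntropy P ν C B := by
  have hf' : Measurable (Prod.map f (id : β → β)) := hf.prodMap measurable_id
  have hg' : Measurable (Prod.map g (id : β → β)) := hg.prodMap measurable_id
  have h := klDiv_map_of_leftInverse (P.map fun ω => (C ω, B ω)) ((P.map C).prod ν) hf' hg'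
    (hgf.prodMap fun _ => rfl)
  rw [Measure.map_map hf' (by fun_prop), ← Measure.map_prod_map _ _ hf measurable_id,
    Measure.map_map hf hC, Measure.map_id] at h
  exact h

/-- Here the reference measure moves along with `B`, hence the invariance hypothesis on `ν`. -/
theorem condRelEntropy_comp_right {C : Ω → γ} {B : Ω → β} (hC : Measurable C) (hB : Measurable B)
    {f g : β → β} (hf : Measurable f) (hg : Measurable g)
    (hgf : Function.LeftInverse g f) (hν : ν.map f = ν) :
    condRelEntropy P ν C (fun ω => f (B ω)) = condRelEntropy P ν C B := by
  have hf' : Measurable (Prod.map (id : γ → γ) f) := measurable_id.prodMap hf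
  have hg' : Measurable (Prod.map (id : γ → γ) g) := measurable_id.prodMap hg
  have h := klDiv_map_of_leftInverse (P.map fun ω => (C ω, B ω)) ((P.map C).prod ν) hf' hg'
    (Function.LeftInverse.prodMap (fun _ => rfl) hgf)
  rw [Measure.map_map hf' (by fun_prop), ← Measure.map_prod_map _ _ measurable_id hf,
    hν, Measure.map_id] at h
  exact h

/-- Chain rule for the pair `(A, B)` relative to a product measure. -/
theorem condRelEntropy_prod [StandardBorelSpace β] [Nonempty β]
    (ρ : Measure α) [IsProbabilityMeasure ρ]
    {C : Ω → γ} {A : Ω → α} {B : Ω → β} (hC : Measurable C) (hA : Measurable A)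
    (hB : Measurable B) :
    condRelEntropy P (ρ.prod ν) C (fun ω => (A ω, B ω))
      = condRelEntropy P ρ C A + condRelEntropy P ν (fun ω => (C ω, A ω)) B := by
  have h := klDiv_compProd_eq_add (P.map fun ω => (C ω, A ω)) ((P.map C).prod ρ)
    (condDistrib B (fun ω => (C ω, A ω)) P) (Kernel.const _ ν)
  rw [compProd_map_condDistrib hB.aemeasurable, Measure.compProd_const,
    Measure.compProd_const] at h
  unfold condRelEntropy
  rw [← h, ← klDiv_map_of_leftInverse _ (((P.map C).prod ρ).prod ν)
    MeasurableEquiv.prodAssoc.measurable MeasurableEquiv.prodAssoc.symm.measurable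
    MeasurableEquiv.prodAssoc.left_inv, Measure.prodAssoc_prod,
    Measure.map_map MeasurableEquiv.prodAssoc.measurable (by fun_prop)]
  rfl

theorem prod_prod_prod_comm_map (μ : Measure γ) (ρ : Measure α) (μ' : Measure δ) (ν : Measure β)
    [IsProbabilityMeasure μ] [IsProbabilityMeasure ρ] [IsProbabilityMeasure μ']
    [IsProbabilityMeasure ν] :
    ((μ.prod ρ).prod (μ'.prod ν)).map (fun q => ((q.1.1, q.2.1), (q.1.2, q.2.2)))
      = (μ.prod μ').prod (ρ.prod ν) := by
  refine Measure.ext_of_lintegral _ fun f hf => ?_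
  rw [lintegral_map hf (by fun_prop), lintegral_prod _ (by fun_prop), lintegral_prod _ (by fun_prop),
    lintegral_prod _ (by fun_prop), lintegral_prod _ (by fun_prop)]
  refine lintegral_congr fun c => ?_
  have h₁ : ∀ a : α, ∫⁻ q : δ × β, f ((c, q.1), (a, q.2)) ∂μ'.prod ν
      = ∫⁻ d, ∫⁻ b, f ((c, d), (a, b)) ∂ν ∂μ' := fun a => lintegral_prod _ (by fun_prop)
  have h₂ : ∀ d : δ, ∫⁻ q : α × β, f ((c, d), q) ∂ρ.prod ν
      = ∫⁻ a, ∫⁻ b, f ((c, d), (a, b)) ∂ν ∂ρ := fun d => lintegral_prod _ (by fun_prop)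
  simp only [h₁, h₂]
  exact lintegral_lintegral_swap (by fun_prop)

/-- Relative entropies add up over independent pairs `(C₁, B₁)` and `(C₂, B₂)`. -/
theorem condRelEntropy_of_indep (ρ : Measure α) [IsProbabilityMeasure ρ]
    {C₁ : Ω → γ} {C₂ : Ω → δ} {A : Ω → α} {B : Ω → β} (hC₁ : Measurable C₁) (hC₂ : Measurable C₂)
    (hA : Measurable A) (hB : Measurable B)
    (hind : P.map (fun ω => ((C₁ ω, A ω), (C₂ ω, B ω)))
      = (P.map fun ω => (C₁ ω, A ω)).prod (P.map fun ω => (C₂ ω, B ω))) :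
    condRelEntropy P (ρ.prod ν) (fun ω => (C₁ ω, C₂ ω)) (fun ω => (A ω, B ω))
      = condRelEntropy P ρ C₁ A + condRelEntropy P ν C₂ B := by
  have : IsProbabilityMeasure (P.map C₁) := Measure.isProbabilityMeasure_map hC₁.aemeasurable
  have : IsProbabilityMeasure (P.map C₂) := Measure.isProbabilityMeasure_map hC₂.aemeasurable
  have : IsProbabilityMeasure (P.map fun ω => (C₁ ω, A ω)) :=
    Measure.isProbabilityMeasure_map (by fun_prop)
  have : IsProbabilityMeasure (P.map fun ω => (C₂ ω, B ω)) :=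
    Measure.isProbabilityMeasure_map (by fun_prop)
  have hC : P.map (fun ω => (C₁ ω, C₂ ω)) = (P.map C₁).prod (P.map C₂) := by
    have h := congrArg (Measure.map (Prod.map Prod.fst Prod.fst)) hind
    rw [Measure.map_map (by fun_prop) (by fun_prop),
      ← Measure.map_prod_map _ _ measurable_fst measurable_fst,
      Measure.map_map measurable_fst (by fun_prop),
      Measure.map_map measurable_fst (by fun_prop)] at h
    exact h
  have hm : Measurable fun q : (γ × α) × (δ × β) => ((q.1.1, q.2.1), (q.1.2, q.2.2)) := by fun_prop
  unfold condRelEntropy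
  rw [← klDiv_prod, ← hind, ← klDiv_map_of_leftInverse _ (Measure.prod _ _) hm
    (g := fun q => ((q.1.1, q.2.1), (q.1.2, q.2.2))) (by fun_prop) (fun _ => rfl),
    Measure.map_map hm (by fun_prop), hC, prod_prod_prod_comm_map]
  rfl

/-- Under conditional independence given `γ`, the `α`-coordinate is drawn without looking at the
`β`-coordinate. -/
theorem compProd_prod_eq_map (μ : Measure γ) [IsFiniteMeasure μ] (κ : Kernel γ α) [IsMarkovKernel κ]
    (η : Kernel γ β) [IsMarkovKernel η] :
    (μ.compProd (κ.prod η)).map (fun q => ((q.1, q.2.2), q.2.1))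
      = (μ.compProd η).compProd (κ.prodMkRight β) := by
  refine Measure.ext_of_lintegral _ fun f hf => ?_
  rw [lintegral_map hf (by fun_prop), Measure.lintegral_compProd (by fun_prop),
    Measure.lintegral_compProd hf, Measure.lintegral_compProd (by fun_prop)]
  refine lintegral_congr fun c => ?_
  rw [Kernel.prod_apply, lintegral_prod_symm' _ (by fun_prop)]
  rfl

/-- The increase of the relative entropy under additional conditioning is the conditional mutual
information. -/
theorem condRelEntropy_prodMk [StandardBorelSpace α] [Nonempty α] [StandardBorelSpace β]
    [Nonempty β] {C : Ω → γ} {A : Ω → α} {B : Ω → β} (hC : Measurable C) (hA : Measurable A)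
    (hB : Measurable B) :
    condRelEntropy P ν (fun ω => (C ω, A ω)) B
      = condMutualInfo P A B C + condRelEntropy P ν C B := by
  -- The reference law draws `C`, then `B` from `ν` and `A` from its law given `C`, independently.
  -- Disintegrating along `(C, B)` gives the right side (`hI`); reading the same reference law as
  -- `P_{C,A} ⊗ ν` gives the left side (`hD`).
  have h := klDiv_compProd_eq_add (P.map fun ω => (C ω, B ω)) ((P.map C).prod ν)
    (condDistrib A (fun ω => (C ω, B ω)) P) ((condDistrib A C P).prodMkRight β)
  have hI : condMutualInfo P A B C = klDiv (P.map fun ω => ((C ω, B ω), A ω))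
      ((P.map fun ω => (C ω, B ω)).compProd ((condDistrib A C P).prodMkRight β)) := by
    rw [condMutualInfo, ← klDiv_map_of_leftInverse _ (Measure.compProd _ _)
      (f := fun q : γ × (α × β) => ((q.1, q.2.2), q.2.1)) (g := fun q => (q.1.1, (q.2, q.1.2)))
      (by fun_prop) (by fun_prop) (fun _ => rfl), compProd_prod_eq_map,
      compProd_map_condDistrib hB.aemeasurable, Measure.map_map (by fun_prop) (by fun_prop)]
    rfl
  have hD : condRelEntropy P ν (fun ω => (C ω, A ω)) B = klDiv (P.map fun ω => ((C ω, B ω), A ω))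
      (((P.map C).prod ν).compProd ((condDistrib A C P).prodMkRight β)) := by
    rw [condRelEntropy, ← klDiv_map_of_leftInverse _ (Measure.prod _ _)
      (f := fun q : (γ × α) × β => ((q.1.1, q.2), q.1.2)) (g := fun q => ((q.1.1, q.2), q.1.2))
      (by fun_prop) (by fun_prop) (fun _ => rfl), ← compProd_map_condDistrib hA.aemeasurable,
      ← Measure.compProd_const (μ := P.map C), ← compProd_prod_eq_map,
      Measure.map_map (by fun_prop) (by fun_prop)]
    congr 1
    refine Measure.ext_of_lintegral _ fun f hf => ?_
    rw [lintegral_map hf (by fun_prop), lintegral_map hf (by fun_prop),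
      lintegral_prod _ (by fun_prop), Measure.lintegral_compProd (by fun_prop),
      Measure.lintegral_compProd (by fun_prop)]
    refine lintegral_congr fun c => ?_
    rw [Kernel.prod_apply, lintegral_prod _ (by fun_prop)]
    rfl
  rw [hI, hD, ← compProd_map_condDistrib hA.aemeasurable, h, add_comm]
  rfl

theorem condMutualInfo_comm [StandardBorelSpace α] [Nonempty α] [StandardBorelSpace β]
    [Nonempty β] {C : Ω → γ} {A : Ω → α} {B : Ω → β} (hC : Measurable C) (hA : Measurable A)
    (hB : Measurable B) : condMutualInfo P A B C = condMutualInfo P B A C := by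
  have hm : Measurable (Prod.map (id : γ → γ) (Prod.swap : α × β → β × α)) := by fun_prop
  rw [condMutualInfo, condMutualInfo, ← klDiv_map_of_leftInverse _ (Measure.compProd _ _) hm
    (g := Prod.map id Prod.swap) (by fun_prop) (fun _ => rfl),
    Measure.map_map hm (by fun_prop)]
  congr 1
  refine Measure.ext_of_lintegral _ fun f hf => ?_
  rw [lintegral_map hf hm, Measure.lintegral_compProd (by fun_prop), Measure.lintegral_compProd hf]
  refine lintegral_congr fun c => ?_
  rw [Kernel.prod_apply, Kernel.prod_apply, lintegral_prod_symm' _ (by fun_prop),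
    lintegral_prod _ (by fun_prop)]
  rfl

/-- Conditional mutual information depends only on the joint law. `W` is only a.e. measurable, as
needed for the final transfer to the canonical space. -/
theorem condMutualInfo_map [StandardBorelSpace α] [Nonempty α] [StandardBorelSpace β]
    [Nonempty β] {Ω' : Type*} [MeasurableSpace Ω'] (W : Ω → Ω') (hW : AEMeasurable W P)
    {C : Ω' → γ} {A : Ω' → α} {B : Ω' → β} (hC : Measurable C) (hA : Measurable A)
    (hB : Measurable B) :
    condMutualInfo P (fun ω => A (W ω)) (fun ω => B (W ω)) (fun ω => C (W ω))
      = condMutualInfo (P.map W) A B C := by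
  unfold condMutualInfo
  rw [condDistrib, condDistrib, condDistrib, condDistrib,
    AEMeasurable.map_map_of_aemeasurable (by fun_prop) hW,
    AEMeasurable.map_map_of_aemeasurable (by fun_prop) hW]
  congr 3
  · congr 2
    exact (AEMeasurable.map_map_of_aemeasurable (g := fun ω => (C ω, A ω)) (by fun_prop) hW).symm
  · congr 2
    exact (AEMeasurable.map_map_of_aemeasurable (g := fun ω => (C ω, B ω)) (by fun_prop) hW).symm

end KL

/-! ### The Gaussian reference measure -/

theorem gaussianReal_one_eq_withDensity (m : ℝ) :
    gaussianReal m 1 = (gaussianReal 0 1).withDensity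
      fun y => ENNReal.ofReal (Real.exp (m * y - m ^ 2 / 2)) := by
  rw [gaussianReal_of_var_ne_zero _ one_ne_zero, gaussianReal_of_var_ne_zero _ one_ne_zero,
    ← withDensity_mul _ (by fun_prop) (by fun_prop)]
  congr 1
  ext y
  simp only [gaussianPDF, gaussianPDFReal, Pi.mul_apply]
  rw [← ENNReal.ofReal_mul (by positivity), mul_assoc _ (Real.exp _),
    ← Real.exp_add]
  congr 4
  simp
  ring

theorem map_shear_gaussian {γ : Type*} [MeasurableSpace γ] (μ : Measure γ) [IsProbabilityMeasure μ]
    {s : γ → ℝ} (hs : Measurable s) :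
    (μ.prod (gaussianReal 0 1)).map (fun q => (q.1, s q.1 + q.2))
      = (μ.prod (gaussianReal 0 1)).withDensity
          fun q => ENNReal.ofReal (Real.exp (s q.1 * q.2 - s q.1 ^ 2 / 2)) := by
  refine Measure.ext_of_lintegral _ fun f hf => ?_
  rw [lintegral_map hf (by fun_prop), lintegral_withDensity_eq_lintegral_mul _ (by fun_prop) hf,
    lintegral_prod _ (by fun_prop), lintegral_prod _ (by fun_prop)]
  refine lintegral_congr fun c => ?_
  have h := gaussianReal_map_const_add (μ := 0) (v := 1) (s c)
  rw [zero_add, gaussianReal_one_eq_withDensity (s c)] at h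
  have h2 := congrArg (fun ρ => ∫⁻ y, f (c, y) ∂ρ) h
  rw [lintegral_map (by fun_prop) (by fun_prop),
    lintegral_withDensity_eq_lintegral_mul _ (by fun_prop) (by fun_prop)] at h2
  exact h2

/-- The log-likelihood ratio is `s y - s² / 2`. Under the shifted law `y = s + z`, so it equals `s²
/ 2 + s z`, and the cross term has mean zero. -/
theorem klDiv_map_shear_gaussian {γ : Type*} [MeasurableSpace γ] (μ : Measure γ)
    [IsProbabilityMeasure μ] {s : γ → ℝ} (hs : Measurable s) (hs2 : MemLp s 2 μ) :
    klDiv ((μ.prod (gaussianReal 0 1)).map fun q => (q.1, s q.1 + q.2))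
      (μ.prod (gaussianReal 0 1)) = ENNReal.ofReal ((∫ c, s c ^ 2 ∂μ) / 2) := by
  set π := μ.prod (gaussianReal 0 1)
  have hm : Measurable fun q : γ × ℝ => (q.1, s q.1 + q.2) := by fun_prop
  have hac : (π.map fun q => (q.1, s q.1 + q.2)) ≪ π := by
    rw [map_shear_gaussian μ hs]; exact withDensity_absolutelyContinuous _ _
  have hllr : llr (π.map fun q => (q.1, s q.1 + q.2)) π
      =ᵐ[π.map fun q => (q.1, s q.1 + q.2)] fun q => s q.1 * q.2 - s q.1 ^ 2 / 2 := by
    refine hac.ae_le ?_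
    rw [map_shear_gaussian μ hs]
    filter_upwards [Measure.rnDeriv_withDensity π
      (f := fun q => ENNReal.ofReal (Real.exp (s q.1 * q.2 - s q.1 ^ 2 / 2))) (by fun_prop)]
      with q hq
    rw [llr, hq, ENNReal.toReal_ofReal (Real.exp_nonneg _), Real.log_exp]
  have hsq : Integrable (fun q : γ × ℝ => s q.1 ^ 2 / 2) π :=
    (hs2.integrable_sq.div_const 2).comp_fst _
  have hsz : Integrable (fun q : γ × ℝ => s q.1 * q.2) π :=
    (hs2.integrable one_le_two).mul_prod (memLp_one_iff_integrable.1 (memLp_id_gaussianReal 1))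
  have hint : Integrable (fun q : γ × ℝ => s q.1 * q.2 - s q.1 ^ 2 / 2)
      (π.map fun q => (q.1, s q.1 + q.2)) := by
    rw [integrable_map_measure (by fun_prop) hm.aemeasurable]
    refine (hsq.add hsz).congr (.of_forall fun q => ?_)
    simp only [Pi.add_apply, Function.comp]
    ring
  have : IsProbabilityMeasure (π.map fun q => (q.1, s q.1 + q.2)) :=
    Measure.isProbabilityMeasure_map hm.aemeasurable
  rw [klDiv_of_ac_of_integrable hac (hint.congr hllr.symm), integral_congr_ae hllr,
    integral_map hm.aemeasurable (by fun_prop)]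
  have : ∀ q : γ × ℝ, s q.1 * (s q.1 + q.2) - s q.1 ^ 2 / 2 = s q.1 ^ 2 / 2 + s q.1 * q.2 :=
    fun q => by ring
  simp only [this]
  rw [integral_add hsq hsz, integral_prod_mul s fun z => z, integral_fun_fst (fun c => s c ^ 2 / 2)]
  simp [integral_div]

theorem condRelEntropy_gaussian {Ω γ : Type*} [MeasurableSpace Ω] [MeasurableSpace γ]
    (P : Measure Ω) [IsProbabilityMeasure P] {C : Ω → γ} {Z Y : Ω → ℝ} (hC : Measurable C)
    (hZ : Measurable Z) (hind : P.map (fun ω => (C ω, Z ω)) = (P.map C).prod (gaussianReal 0 1))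
    {s : γ → ℝ} (hs : Measurable s) (hs2 : MemLp (fun ω => s (C ω)) 2 P)
    (hY : ∀ ω, Y ω = s (C ω) + Z ω) :
    condRelEntropy P (gaussianReal 0 1) C Y = ENNReal.ofReal ((∫ ω, s (C ω) ^ 2 ∂P) / 2) := by
  have : IsProbabilityMeasure (P.map C) := Measure.isProbabilityMeasure_map hC.aemeasurable
  have h := klDiv_map_shear_gaussian (P.map C) hs
    ((memLp_map_measure_iff hs.aestronglyMeasurable hC.aemeasurable).2 hs2)
  rw [← hind, Measure.map_map (by fun_prop) (by fun_prop), hind,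
    integral_map hC.aemeasurable (by fun_prop)] at h
  rw [← h, condRelEntropy]
  congr 3
  funext ω
  simp [hY]

theorem gaussianReal_prod_map_rotation :
    ((gaussianReal 0 1).prod (gaussianReal 0 1)).map
      (fun z => (1 / √2 * (z.1 + z.2), 1 / √2 * (z.1 - z.2)))
      = (gaussianReal 0 1).prod (gaussianReal 0 1) := by
  -- The map has determinant `-1`: it is a rotation by an eighth of a turn followed by a coordinate
  -- swap.
  have h := IsGaussian.map_rotation_eq_self_of_forall_strongDual_eq_zero
    (μ := gaussianReal 0 1) (fun L => by simp [integral_continuousLinearMap_gaussianReal])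
    (-(Real.pi / 4))
  have h2 := congrArg (Measure.map Prod.swap) h
  rw [Measure.prod_swap, Measure.map_map measurable_swap (by fun_prop)] at h2
  rw [← h2]
  congr 1
  funext z
  have hr : √2 / 2 = 1 / √2 := by rw [div_eq_div_iff (by norm_num) (by norm_num)]; norm_num
  simp only [Function.comp, ContinuousLinearMap.rotation_apply, Prod.swap, Real.cos_neg,
    Real.sin_neg, Real.cos_pi_div_four, Real.sin_pi_div_four, smul_eq_mul, hr]
  ext <;> simp <;> ring

/-! ### The Lagrangian in terms of relative entropies -/

variable {J : ℕ}

/-- The relative entropy of the channel law from the standard normal law, `E[(∑ X_j)²] / 2`. -/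
def halfPower (K : Matrix (Fin J) (Fin J) ℝ) : ℝ := (∑ i, ∑ j, K i j) / 2

section Channel

variable {Ω α γ τ : Type*} [MeasurableSpace Ω] [MeasurableSpace α] [MeasurableSpace γ]
  [MeasurableSpace τ]

theorem map_prodMk_comp_eq_prod (P : Measure Ω) [IsProbabilityMeasure P] (ν : Measure α)
    [IsProbabilityMeasure ν] {δ : Type*} [MeasurableSpace δ] {C : Ω → γ} {Z : Ω → α}
    (hC : Measurable C) (hZ : Measurable Z)
    (h : P.map (fun ω => (C ω, Z ω)) = (P.map C).prod ν) {f : γ → δ} (hf : Measurable f) :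
    P.map (fun ω => (f (C ω), Z ω)) = (P.map fun ω => f (C ω)).prod ν := by
  have h2 := congrArg (Measure.map (Prod.map f (id : α → α))) h
  rw [Measure.map_map (hf.prodMap measurable_id) (by fun_prop),
    ← Measure.map_prod_map _ _ hf measurable_id, Measure.map_id, Measure.map_map hf hC] at h2
  exact h2

theorem memLp_sum_of_hasSecondMoment {P : Measure (Fin J → ℝ)}
    {K : Matrix (Fin J) (Fin J) ℝ} (hK : HasSecondMoment P K) :
    MemLp (fun x : Fin J → ℝ => ∑ j, x j) 2 P :=
  memLp_finsetSum _ fun i _ => hK.1 i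

theorem integral_sum_sq_of_hasSecondMoment {P : Measure (Fin J → ℝ)}
    {K : Matrix (Fin J) (Fin J) ℝ} (hK : HasSecondMoment P K) :
    (∫ x : Fin J → ℝ, (∑ j, x j) ^ 2 ∂P) / 2 = halfPower K := by
  have hint : ∀ i j, Integrable (fun x : Fin J → ℝ => x i * x j) P :=
    fun i j => (hK.1 i).integrable_mul (hK.1 j)
  simp only [halfPower, pow_two, Finset.sum_mul_sum]
  rw [integral_finsetSum _ fun i _ => integrable_finsetSum _ fun j _ => hint i j]
  congr 1
  refine Finset.sum_congr rfl fun i _ => ?_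
  rw [integral_finsetSum _ fun j _ => hint i j]
  exact Finset.sum_congr rfl fun j _ => hK.2 i j

/-- `Y = X_1 + ⋯ + X_J + Z` with `Z` standard normal and independent of `(T, X)`, where
`E[X Xᵀ] = K`. -/
structure IsChannel (P : Measure Ω) (K : Matrix (Fin J) (Fin J) ℝ) (T : Ω → τ)
    (X : Ω → Fin J → ℝ) (Z Y : Ω → ℝ) : Prop where
  measurable_T : Measurable T
  measurable_X : Measurable X
  measurable_Z : Measurable Z
  indep : P.map (fun ω => ((T ω, X ω), Z ω))
    = (P.map fun ω => (T ω, X ω)).prod (gaussianReal 0 1)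
  moment : HasSecondMoment (P.map X) K
  output : ∀ ω, Y ω = (∑ j, X ω j) + Z ω

namespace IsChannel

variable {P : Measure Ω} {K : Matrix (Fin J) (Fin J) ℝ} {T : Ω → τ}
  {X : Ω → Fin J → ℝ} {Z Y : Ω → ℝ}

theorem measurable_Y (h : IsChannel P K T X Z Y) : Measurable Y := by
  have := h.measurable_X
  have := h.measurable_Z
  rw [funext h.output]
  fun_prop

variable [IsProbabilityMeasure P]

/-- Part of the input may be added to the side information. -/
theorem restrict_prodMk (h : IsChannel P K T X Z Y) (S : Finset (Fin J)) :
    IsChannel P K (fun ω => (S.restrict (X ω), T ω)) X Z Y := by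
  have hT := h.measurable_T
  have hX := h.measurable_X
  have hZ := h.measurable_Z
  have hr : Measurable (S.restrict : (Fin J → ℝ) → S → ℝ) := Finset.measurable_restrict S
  exact ⟨by fun_prop, hX, hZ, map_prodMk_comp_eq_prod P _ (by fun_prop) hZ h.indep
    (f := fun q => ((S.restrict q.2, q.1), q.2)) (by fun_prop), h.moment, h.output⟩

theorem condRelEntropy_input (h : IsChannel P K T X Z Y) :
    condRelEntropy P (gaussianReal 0 1) (fun ω => (T ω, X ω)) Y
      = ENNReal.ofReal (halfPower K) := by
  have hT := h.measurable_T
  have hX := h.measurable_X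
  have hZ := h.measurable_Z
  rw [condRelEntropy_gaussian P (by fun_prop) hZ h.indep
    (s := fun q : τ × (Fin J → ℝ) => ∑ j, q.2 j) (by fun_prop)
    ((memLp_map_measure_iff (by fun_prop) hX.aemeasurable).1
      (memLp_sum_of_hasSecondMoment h.moment)) h.output,
    ← integral_sum_sq_of_hasSecondMoment h.moment, integral_map hX.aemeasurable (by fun_prop)]

/-- If `(C, A)` carries the same information as `(T, X)`, then `I(A; Y | C)` is the difference of
relative entropies. -/
theorem toReal_condMutualInfo [StandardBorelSpace α] [Nonempty α]
    (h : IsChannel P K T X Z Y) {f : τ × (Fin J → ℝ) → γ × α}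
    {g : γ × α → τ × (Fin J → ℝ)} (hf : Measurable f) (hg : Measurable g)
    (hgf : Function.LeftInverse g f) :
    (condMutualInfo P (fun ω => (f (T ω, X ω)).2) Y (fun ω => (f (T ω, X ω)).1)).toReal
      = halfPower K
        - (condRelEntropy P (gaussianReal 0 1) (fun ω => (f (T ω, X ω)).1) Y).toReal ∧
    condRelEntropy P (gaussianReal 0 1) (fun ω => (f (T ω, X ω)).1) Y ≠ ⊤ := by
  have hT := h.measurable_T
  have hX := h.measurable_X
  have hY := h.measurable_Y
  have h1 := condRelEntropy_prodMk P (gaussianReal 0 1)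
    (C := fun ω => (f (T ω, X ω)).1) (A := fun ω => (f (T ω, X ω)).2) (by fun_prop) (by fun_prop) hY
  have h2 : condRelEntropy P (gaussianReal 0 1) (fun ω => f (T ω, X ω)) Y
      = ENNReal.ofReal (halfPower K) := by
    rw [← h.condRelEntropy_input]
    exact condRelEntropy_comp_left P _ (C := fun ω => (T ω, X ω)) (by fun_prop) hY hf hg hgf
  -- The information and the relative entropy add up to a real number, so both are finite and
  -- `toReal` loses nothing.
  have h3 : ENNReal.ofReal (halfPower K) = _ := h2.symm.trans h1
  have hne := ENNReal.add_ne_top.1 (h3 ▸ ENNReal.ofReal_ne_top)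
  refine ⟨?_, hne.2⟩
  have hK : 0 ≤ halfPower K := by
    rw [← integral_sum_sq_of_hasSecondMoment h.moment]
    have : 0 ≤ ∫ x : Fin J → ℝ, (∑ j, x j) ^ 2 ∂(P.map X) :=
      integral_nonneg fun x => sq_nonneg _
    positivity
  have h4 := congrArg ENNReal.toReal h3
  rw [ENNReal.toReal_ofReal hK, ENNReal.toReal_add hne.1 hne.2] at h4
  linarith

theorem toReal_condMutualInfo_input (h : IsChannel P K T X Z Y) :
    (condMutualInfo P X Y T).toReal
      = halfPower K - (condRelEntropy P (gaussianReal 0 1) T Y).toReal :=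
  (h.toReal_condMutualInfo measurable_id measurable_id fun _ => rfl).1

theorem condRelEntropy_ne_top (h : IsChannel P K T X Z Y) :
    condRelEntropy P (gaussianReal 0 1) T Y ≠ ⊤ :=
  (h.toReal_condMutualInfo measurable_id measurable_id fun _ => rfl).2

theorem toReal_condMutualInfo_restrict (h : IsChannel P K T X Z Y) (S : Finset (Fin J)) :
    (condMutualInfo P (fun ω => Sᶜ.restrict (X ω)) Y (fun ω => (S.restrict (X ω), T ω))).toReal
      = halfPower K
        - (condRelEntropy P (gaussianReal 0 1) (fun ω => (S.restrict (X ω), T ω)) Y).toReal := by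
  have hr : ∀ S : Finset (Fin J), Measurable (S.restrict : (Fin J → ℝ) → S → ℝ) :=
    fun S => Finset.measurable_restrict S
  refine (h.toReal_condMutualInfo
    (f := fun q => ((S.restrict q.2, q.1), Sᶜ.restrict q.2))
    -- The inverse reassembles `X` from its blocks `S` and `Sᶜ`.
    (g := fun q => (q.1.2, fun j => if hj : j ∈ S then q.1.1 ⟨j, hj⟩
      else q.2 ⟨j, Finset.mem_compl.2 hj⟩)) (by fun_prop) ?_ ?_).1
  · refine Measurable.prodMk (by fun_prop) (measurable_pi_lambda _ fun j => ?_)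
    by_cases hj : j ∈ S
    · simp only [hj, dite_true]; fun_prop
    · simp only [hj, dite_false]; fun_prop
  · intro q
    ext j
    · rfl
    · by_cases hj : j ∈ S <;> simp [hj]

theorem lagrangian_eq (h : IsChannel P K T X Z Y)
    (𝒮 : Finpartition (Finset.univ : Finset (Fin J))) (lam : ℝ) :
    lagrangian 𝒮 lam P T X Y
      = (lam - 1) * (halfPower K - (condRelEntropy P (gaussianReal 0 1) T Y).toReal)
        - lam / ((𝒮.parts.card : ℝ) - 1) * ∑ S ∈ 𝒮.parts, (halfPower K
          - (condRelEntropy P (gaussianReal 0 1) (fun ω => (S.restrict (X ω), T ω)) Y).toReal) := by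
  rw [lagrangian, h.toReal_condMutualInfo_input]
  simp only [h.toReal_condMutualInfo_restrict]

theorem lowerS_map_eq (h : IsChannel P K T X Z Y)
    (𝒮 : Finpartition (Finset.univ : Finset (Fin J))) (lam : ℝ)
    [IsProbabilityMeasure (P.map fun ω => (T ω, X ω))] :
    lowerS 𝒮 lam (P.map fun ω => (T ω, X ω)) = lagrangian 𝒮 lam P T X Y := by
  have hT := h.measurable_T
  have hX := h.measurable_X
  have hZ := h.measurable_Z
  have hr : ∀ S : Finset (Fin J), Measurable (S.restrict : (Fin J → ℝ) → S → ℝ) :=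
    fun S => Finset.measurable_restrict S
  have hW : AEMeasurable (fun ω => ((T ω, X ω), Z ω)) P := by fun_prop
  -- The measure is generalized to `Q` because `lagrangian` carries a finiteness instance that
  -- depends on it.
  have key : ∀ (Q : Measure ((τ × (Fin J → ℝ)) × ℝ)) [IsFiniteMeasure Q],
      Q = P.map (fun ω => ((T ω, X ω), Z ω)) →
      lagrangian 𝒮 lam Q (fun ω => ω.1.1) (fun ω => ω.1.2) (fun ω => (∑ j, ω.1.2 j) + ω.2)
        = lagrangian 𝒮 lam P T X Y := by
    rintro Q _ rfl
    rw [funext h.output, lagrangian, lagrangian, ← condMutualInfo_map P _ hW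
      (by fun_prop) (by fun_prop) (by fun_prop)]
    congr 2
    refine Finset.sum_congr rfl fun S _ => ?_
    rw [← condMutualInfo_map P _ hW (by fun_prop) (by fun_prop) (by fun_prop)]
  exact key _ h.indep.symm

end IsChannel

end Channel

theorem dualValue_le {τ : Type} [MeasurableSpace τ]
    (𝒮 : Finpartition (Finset.univ : Finset (Fin J))) (lam : ℝ)
    (K : Matrix (Fin J) (Fin J) ℝ) (μ : Measure (τ × (Fin J → ℝ))) [hμ : IsProbabilityMeasure μ]
    (hK : HasSecondMoment μ.snd K) : dualValue 𝒮 lam K ≤ (lowerS 𝒮 lam μ : EReal) := by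
  have hprob : IsProbabilityMeasure μ.snd := inferInstance
  refine iInf_le_of_le μ.snd <| iInf_le_of_le hprob <| iInf_le_of_le hK ?_
  exact iInf_le_of_le τ <| iInf_le_of_le _ <| iInf_le_of_le μ <| iInf_le_of_le hμ <|
    iInf_le_of_le rfl le_rfl

theorem IsChannel.dualValue_le_lagrangian {Ω : Type*} {τ : Type} [MeasurableSpace Ω]
    [MeasurableSpace τ] {P : Measure Ω} [IsProbabilityMeasure P] {K : Matrix (Fin J) (Fin J) ℝ}
    {T : Ω → τ} {X : Ω → Fin J → ℝ} {Z Y : Ω → ℝ} (h : IsChannel P K T X Z Y)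
    (𝒮 : Finpartition (Finset.univ : Finset (Fin J))) (lam : ℝ) :
    dualValue 𝒮 lam K ≤ (lagrangian 𝒮 lam P T X Y : EReal) := by
  have hT := h.measurable_T
  have hX := h.measurable_X
  have : IsProbabilityMeasure (P.map fun ω => (T ω, X ω)) :=
    Measure.isProbabilityMeasure_map (by fun_prop)
  rw [← h.lowerS_map_eq]
  refine dualValue_le 𝒮 lam K _ ?_
  rw [Measure.snd_map_prodMk hT]
  exact h.moment

/-! ### Splitting a two-letter Lagrangian -/

section TwoLetter

variable {Ω : Type*} {τ : Type} [MeasurableSpace Ω] [MeasurableSpace τ]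

/-- The Lagrangian of two uses of the channel with inputs `A` and `B`. -/
def twoLetterLagrangian (𝒮 : Finpartition (Finset.univ : Finset (Fin J))) (lam : ℝ)
    (K : Matrix (Fin J) (Fin J) ℝ) (P : Measure Ω) (T : Ω → τ) (A B : Ω → Fin J → ℝ)
    (U V : Ω → ℝ) : ℝ :=
  (lam - 1) * (2 * halfPower K - (condRelEntropy P ((gaussianReal 0 1).prod (gaussianReal 0 1)) T
      (fun ω => (U ω, V ω))).toReal)
    - lam / ((𝒮.parts.card : ℝ) - 1) * ∑ S ∈ 𝒮.parts, (2 * halfPower K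
      - (condRelEntropy P ((gaussianReal 0 1).prod (gaussianReal 0 1))
        (fun ω => ((S.restrict (A ω), S.restrict (B ω)), T ω)) (fun ω => (U ω, V ω))).toReal)

/-- The squeeze: a total of `2 v` is written as two Lagrangians, each at least `v`, plus nonnegative
information terms. -/
theorem attains_of_twoLetterLagrangian_eq (𝒮 : Finpartition (Finset.univ : Finset (Fin J)))
    (hM : 2 ≤ 𝒮.parts.card) (lam : ℝ) (hlam : 0 ≤ lam) (K : Matrix (Fin J) (Fin J) ℝ)
    (P : Measure Ω) [IsProbabilityMeasure P]
    {T : Ω → τ} {A B : Ω → Fin J → ℝ} {N₁ N₂ U V : Ω → ℝ} (hT : Measurable T) (hA : Measurable A)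
    (hB : Measurable B) (hN₁ : Measurable N₁) (hN₂ : Measurable N₂)
    (hind : P.map (fun ω => ((T ω, A ω, B ω), (N₁ ω, N₂ ω)))
      = (P.map fun ω => (T ω, A ω, B ω)).prod ((gaussianReal 0 1).prod (gaussianReal 0 1)))
    (hKA : HasSecondMoment (P.map A) K) (hKB : HasSecondMoment (P.map B) K)
    (hU : ∀ ω, U ω = (∑ j, A ω j) + N₁ ω) (hV : ∀ ω, V ω = (∑ j, B ω j) + N₂ ω)
    {v : ℝ} (hv : dualValue 𝒮 lam K = v)
    (htwo : twoLetterLagrangian 𝒮 lam K P T A B U V = 2 * v) :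
    Attains 𝒮 lam K (P.map fun ω => (T ω, A ω)) ∧
    (0 < lam → ∀ S ∈ 𝒮.parts,
      condMutualInfo P U (fun ω => S.restrict (B ω)) (fun ω => (S.restrict (A ω), T ω)) = 0 ∧
      condMutualInfo P V (fun ω => S.restrict (A ω))
        (fun ω => (U ω, S.restrict (B ω), T ω)) = 0) := by
  have hr : ∀ S : Finset (Fin J), Measurable (S.restrict : (Fin J → ℝ) → S → ℝ) :=
    fun S => Finset.measurable_restrict S
  have hUm : Measurable U := by rw [funext hU]; fun_prop
  have hVm : Measurable V := by rw [funext hV]; fun_prop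
  have h₁ : P.map (fun ω => ((T ω, A ω, B ω), N₁ ω))
      = (P.map fun ω => (T ω, A ω, B ω)).prod (gaussianReal 0 1) := by
    have h := congrArg (Measure.map (Prod.map (id : τ × (Fin J → ℝ) × (Fin J → ℝ) → _)
      (Prod.fst : ℝ × ℝ → ℝ))) hind
    rw [Measure.map_map (by fun_prop) (by fun_prop), ← Measure.map_prod_map _ _ measurable_id
      measurable_fst, Measure.map_id, ← Measure.fst, Measure.fst_prod] at h
    exact h
  have h₂ : P.map (fun ω => (((T ω, A ω, B ω), N₁ ω), N₂ ω))
      = (P.map fun ω => ((T ω, A ω, B ω), N₁ ω)).prod (gaussianReal 0 1) := by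
    rw [h₁]
    have h := congrArg (Measure.map MeasurableEquiv.prodAssoc.symm) hind
    rw [Measure.map_map (by fun_prop) (by fun_prop), ← Measure.prodAssoc_prod,
      MeasurableEquiv.map_symm_map] at h
    exact h
  have hm₁ : Measurable fun ω => (T ω, A ω, B ω) := by fun_prop
  have hm₂ : Measurable fun ω => ((T ω, A ω, B ω), N₁ ω) := by fun_prop
  have chA : IsChannel P K T A N₁ U := ⟨hT, hA, hN₁,
    map_prodMk_comp_eq_prod P _ hm₁ hN₁ h₁ (f := fun q => (q.1, q.2.1)) (by fun_prop), hKA, hU⟩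
  -- The first output joins the side information of the second use; it is a function of `(T, A, B,
  -- N₁)`, hence independent of `N₂` jointly with `B`.
  have chB : IsChannel P K (fun ω => (U ω, T ω)) B N₂ V := by
    refine ⟨by fun_prop, hB, hN₂, ?_, hKB, hV⟩
    simp only [hU]
    exact map_prodMk_comp_eq_prod P _ hm₂ hN₂ h₂
      (f := fun q => (((∑ j, q.1.2.1 j) + q.2, q.1.1), q.1.2.2)) (by fun_prop)
  -- These two families of channels serve only to show finiteness in `fin`.
  have chA' : ∀ S : Finset (Fin J), IsChannel P K
      (fun ω => ((S.restrict (A ω), S.restrict (B ω)), T ω)) A N₁ U := fun S =>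
    ⟨by fun_prop, hA, hN₁, map_prodMk_comp_eq_prod P _ hm₁ hN₁ h₁
      (f := fun q => (((S.restrict q.2.1, S.restrict q.2.2), q.1), q.2.1)) (by fun_prop), hKA, hU⟩
  have chB' : ∀ S : Finset (Fin J), IsChannel P K
      (fun ω => (((S.restrict (A ω), S.restrict (B ω)), T ω), U ω)) B N₂ V := by
    refine fun S => ⟨by fun_prop, hB, hN₂, ?_, hKB, hV⟩
    simp only [hU]
    exact map_prodMk_comp_eq_prod P _ hm₂ hN₂ h₂
      (f := fun q => ((((S.restrict q.1.2.1, S.restrict q.1.2.2), q.1.1),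
        (∑ j, q.1.2.1 j) + q.2), q.1.2.2)) (by fun_prop)
  set G := gaussianReal 0 1 with hG
  have split₀ : (condRelEntropy P (G.prod G) T (fun ω => (U ω, V ω))).toReal
      = (condRelEntropy P G T U).toReal
        + (condRelEntropy P G (fun ω => (U ω, T ω)) V).toReal := by
    rw [condRelEntropy_prod P G G hT hUm hVm,
      condRelEntropy_comp_left P G (C := fun ω => (U ω, T ω)) (by fun_prop) hVm
        (f := fun q => (q.2, q.1)) measurable_swap measurable_swap Prod.swap_leftInverse,
      ENNReal.toReal_add chA.condRelEntropy_ne_top chB.condRelEntropy_ne_top]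
  -- After the chain rule, `U` is conditioned on `B_S` and `V` on `A_S` beyond what the
  -- single-letter Lagrangians use; each excess is a conditional mutual information.
  have split : ∀ S : Finset (Fin J),
      condRelEntropy P (G.prod G) (fun ω => ((S.restrict (A ω), S.restrict (B ω)), T ω))
          (fun ω => (U ω, V ω))
        = (condMutualInfo P U (fun ω => S.restrict (B ω)) (fun ω => (S.restrict (A ω), T ω))
          + condRelEntropy P G (fun ω => (S.restrict (A ω), T ω)) U)
        + (condMutualInfo P V (fun ω => S.restrict (A ω)) (fun ω => (U ω, S.restrict (B ω), T ω))
          + condRelEntropy P G (fun ω => (S.restrict (B ω), (U ω, T ω))) V) := by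
    intro S
    rw [condRelEntropy_prod P G G (by fun_prop) hUm hVm]
    congr 1
    · rw [condMutualInfo_comm P (by fun_prop) hUm (by fun_prop),
        ← condRelEntropy_prodMk P G (by fun_prop) (by fun_prop) hUm]
      exact condRelEntropy_comp_left P G
        (C := fun ω => ((S.restrict (A ω), T ω), S.restrict (B ω))) (by fun_prop) hUm
        (f := fun q => ((q.1.1, q.2), q.1.2)) (g := fun q => ((q.1.1, q.2), q.1.2))
        (by fun_prop) (by fun_prop) (fun _ => rfl)
    · rw [condMutualInfo_comm P (by fun_prop) hVm (by fun_prop),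
        condRelEntropy_comp_left P G (C := fun ω => (U ω, S.restrict (B ω), T ω))
        (by fun_prop) hVm (f := fun q => (q.2.1, (q.1, q.2.2)))
        (g := fun q => (q.2.1, (q.1, q.2.2))) (by fun_prop) (by fun_prop) (fun _ => rfl),
        ← condRelEntropy_prodMk P G (by fun_prop) (by fun_prop) hVm]
      exact condRelEntropy_comp_left P G
        (C := fun ω => ((U ω, S.restrict (B ω), T ω), S.restrict (A ω))) (by fun_prop) hVm
        (f := fun q => (((q.2, q.1.2.1), q.1.2.2), q.1.1))
        (g := fun q => ((q.2, q.1.1.2, q.1.2), q.1.1.1))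
        (by fun_prop) (by fun_prop) (fun _ => rfl)
  have fin : ∀ S : Finset (Fin J),
      condRelEntropy P (G.prod G) (fun ω => ((S.restrict (A ω), S.restrict (B ω)), T ω))
          (fun ω => (U ω, V ω)) ≠ ⊤ := by
    intro S
    rw [condRelEntropy_prod P G G (by fun_prop) hUm hVm]
    exact ENNReal.add_ne_top.2 ⟨(chA' S).condRelEntropy_ne_top, (chB' S).condRelEntropy_ne_top⟩
  have fin' := fun S => by simpa only [split S, ENNReal.add_ne_top] using fin S
  have sA := chA.dualValue_le_lagrangian 𝒮 lam
  have sB := chB.dualValue_le_lagrangian 𝒮 lam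
  rw [hv, EReal.coe_le_coe_iff] at sA sB
  have hc : 0 ≤ lam / ((𝒮.parts.card : ℝ) - 1) := by
    have : (2 : ℝ) ≤ 𝒮.parts.card := by exact_mod_cast hM
    exact div_nonneg hlam (by linarith)
  have hsum : lagrangian 𝒮 lam P T A U + lagrangian 𝒮 lam P (fun ω => (U ω, T ω)) B V
      + lam / ((𝒮.parts.card : ℝ) - 1) * ∑ S ∈ 𝒮.parts,
        ((condMutualInfo P U (fun ω => S.restrict (B ω))
            (fun ω => (S.restrict (A ω), T ω))).toReal
          + (condMutualInfo P V (fun ω => S.restrict (A ω))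
            (fun ω => (U ω, S.restrict (B ω), T ω))).toReal) = 2 * v := by
    rw [← htwo, chA.lagrangian_eq, chB.lagrangian_eq, twoLetterLagrangian, ← hG, split₀]
    have : ∀ a b c x y z k : ℝ, a * x - k * y + (a * z - k * b) + k * c
        = a * (x + z) - k * (y + b - c) := fun a b c x y z k => by ring
    rw [this, ← Finset.sum_add_distrib, ← Finset.sum_sub_distrib]
    congr 1
    · ring
    · congr 1
      refine Finset.sum_congr rfl fun S _ => ?_
      obtain ⟨⟨f1, f2⟩, f3, f4⟩ := fin' S
      rw [split S, ENNReal.toReal_add (ENNReal.add_ne_top.2 ⟨f1, f2⟩)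
        (ENNReal.add_ne_top.2 ⟨f3, f4⟩), ENNReal.toReal_add f1 f2, ENNReal.toReal_add f3 f4]
      ring
  have hnn : ∀ S ∈ 𝒮.parts, 0 ≤ (condMutualInfo P U (fun ω => S.restrict (B ω))
            (fun ω => (S.restrict (A ω), T ω))).toReal
          + (condMutualInfo P V (fun ω => S.restrict (A ω))
            (fun ω => (U ω, S.restrict (B ω), T ω))).toReal := fun S _ => by positivity
  have hnn' := mul_nonneg hc (Finset.sum_nonneg hnn)
  refine ⟨⟨Measure.isProbabilityMeasure_map (by fun_prop), ?_, ?_⟩, fun hpos S hS => ?_⟩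
  · rw [Measure.snd_map_prodMk hT]; exact hKA
  · have : IsProbabilityMeasure (P.map fun ω => (T ω, A ω)) :=
      Measure.isProbabilityMeasure_map (by fun_prop)
    rw [chA.lowerS_map_eq, hv, EReal.coe_eq_coe_iff]
    linarith
  · have hcpos : 0 < lam / ((𝒮.parts.card : ℝ) - 1) := by
      have : (2 : ℝ) ≤ 𝒮.parts.card := by exact_mod_cast hM
      exact div_pos hpos (by linarith)
    have h0 := (mul_eq_zero.1 (le_antisymm (by linarith) hnn')).resolve_left hcpos.ne'
    have hS0 := (Finset.sum_eq_zero_iff_of_nonneg hnn).1 h0 S hS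
    -- Finiteness excludes the case where `toReal` vanishes because the value is `⊤`.
    obtain ⟨⟨f1, -⟩, f3, -⟩ := fin' S
    have h1 := (add_eq_zero_iff_of_nonneg ENNReal.toReal_nonneg ENNReal.toReal_nonneg).1 hS0
    exact ⟨((ENNReal.toReal_eq_zero_iff _).1 h1.1).resolve_right f1,
      ((ENNReal.toReal_eq_zero_iff _).1 h1.2).resolve_right f3⟩

end TwoLetter

/-! ### Invariance of the two-letter Lagrangian -/

/-- The reflection `(a, b) ↦ ((a + b) / √2, (a - b) / √2)`. -/
def sumDiff {E : Type*} [AddCommGroup E] [Module ℝ E] (q : E × E) : E × E :=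
  ((1 / √2 : ℝ) • (q.1 + q.2), (1 / √2 : ℝ) • (q.1 - q.2))

theorem sumDiff_involutive {E : Type*} [AddCommGroup E] [Module ℝ E] :
    Function.Involutive (sumDiff (E := E)) := by
  have hr : (1 / √2 : ℝ) * (1 / √2) = 1 / 2 := by
    rw [div_mul_div_comm, Real.mul_self_sqrt (by norm_num), one_mul]
  intro q
  ext
  · simp only [sumDiff, ← smul_add, smul_smul, hr]
    rw [add_add_sub_cancel, ← two_smul ℝ, smul_smul]
    norm_num
  · simp only [sumDiff, ← smul_sub, smul_smul, hr]
    rw [add_sub_sub_cancel, ← two_smul ℝ, smul_smul]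
    norm_num

theorem measurable_sumDiff {E : Type*} [AddCommGroup E] [Module ℝ E] [MeasurableSpace E]
    [MeasurableAdd₂ E] [MeasurableSub₂ E] [MeasurableConstSMul ℝ E] :
    Measurable (sumDiff (E := E)) := by
  unfold sumDiff
  fun_prop

section TwoLetter

variable {Ω : Type*} {τ : Type} [MeasurableSpace Ω] [MeasurableSpace τ]
  (𝒮 : Finpartition (Finset.univ : Finset (Fin J))) (lam : ℝ) (K : Matrix (Fin J) (Fin J) ℝ)
  (P : Measure Ω) [IsProbabilityMeasure P]

/-- The involution `sumDiff` preserves the Gaussian reference measure and acts on each pair of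
blocks separately. -/
theorem twoLetterLagrangian_sumDiff {T : Ω → τ} {A B : Ω → Fin J → ℝ} {U V : Ω → ℝ}
    (hT : Measurable T) (hA : Measurable A) (hB : Measurable B) (hU : Measurable U)
    (hV : Measurable V) :
    twoLetterLagrangian 𝒮 lam K P T (fun ω => (sumDiff (A ω, B ω)).1)
        (fun ω => (sumDiff (A ω, B ω)).2) (fun ω => (sumDiff (U ω, V ω)).1)
        (fun ω => (sumDiff (U ω, V ω)).2)
      = twoLetterLagrangian 𝒮 lam K P T A B U V := by
  have hr : ∀ S : Finset (Fin J), Measurable (S.restrict : (Fin J → ℝ) → S → ℝ) :=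
    fun S => Finset.measurable_restrict S
  have key : ∀ {γ : Type} [MeasurableSpace γ] {C : Ω → γ}, Measurable C →
      condRelEntropy P ((gaussianReal 0 1).prod (gaussianReal 0 1)) C
          (fun ω => sumDiff (U ω, V ω))
        = condRelEntropy P ((gaussianReal 0 1).prod (gaussianReal 0 1)) C
          (fun ω => (U ω, V ω)) := fun hC =>
    condRelEntropy_comp_right P _ hC (by fun_prop) measurable_sumDiff measurable_sumDiff
      sumDiff_involutive.leftInverse gaussianReal_prod_map_rotation
  have hcond : ∀ S : Finset (Fin J),
      condRelEntropy P ((gaussianReal 0 1).prod (gaussianReal 0 1))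
          (fun ω => (sumDiff (S.restrict (A ω), S.restrict (B ω)), T ω)) (fun ω => (U ω, V ω))
        = condRelEntropy P ((gaussianReal 0 1).prod (gaussianReal 0 1))
          (fun ω => ((S.restrict (A ω), S.restrict (B ω)), T ω)) (fun ω => (U ω, V ω)) := fun S =>
    condRelEntropy_comp_left P _ (C := fun ω => ((S.restrict (A ω), S.restrict (B ω)), T ω))
      (by fun_prop) (by fun_prop) (f := Prod.map sumDiff id) (g := Prod.map sumDiff id)
      (measurable_sumDiff.prodMap measurable_id) (measurable_sumDiff.prodMap measurable_id)
      (sumDiff_involutive.leftInverse.prodMap fun _ => rfl)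
  unfold twoLetterLagrangian
  simp only [← hcond, ← key hT]
  congr 2
  refine Finset.sum_congr rfl fun S _ => ?_
  have hS : Measurable fun ω => (S.restrict (A ω), S.restrict (B ω)) := by fun_prop
  rw [← key (C := fun ω => (sumDiff (S.restrict (A ω), S.restrict (B ω)), T ω))
    ((measurable_sumDiff.comp hS).prodMk hT)]
  -- Restriction to a block commutes with `sumDiff` definitionally.
  rfl

theorem twoLetterLagrangian_swap {T : Ω → τ} {A B : Ω → Fin J → ℝ} {U V : Ω → ℝ}
    (hT : Measurable T) (hA : Measurable A) (hB : Measurable B) (hU : Measurable U)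
    (hV : Measurable V) :
    twoLetterLagrangian 𝒮 lam K P T B A V U = twoLetterLagrangian 𝒮 lam K P T A B U V := by
  have hr : ∀ S : Finset (Fin J), Measurable (S.restrict : (Fin J → ℝ) → S → ℝ) :=
    fun S => Finset.measurable_restrict S
  have key : ∀ {γ : Type} [MeasurableSpace γ] {C : Ω → γ}, Measurable C →
      condRelEntropy P ((gaussianReal 0 1).prod (gaussianReal 0 1)) C (fun ω => (V ω, U ω))
        = condRelEntropy P ((gaussianReal 0 1).prod (gaussianReal 0 1)) C
          (fun ω => (U ω, V ω)) := fun hC =>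
    condRelEntropy_comp_right P _ (B := fun ω => (U ω, V ω)) hC (by fun_prop) (f := fun q => (q.2, q.1))
      measurable_swap measurable_swap Prod.swap_leftInverse Measure.prod_swap
  unfold twoLetterLagrangian
  rw [key hT]
  congr 2
  refine Finset.sum_congr rfl fun S _ => ?_
  rw [key (by fun_prop), condRelEntropy_comp_left P _
    (C := fun ω => ((S.restrict (A ω), S.restrict (B ω)), T ω))
    (by fun_prop) (by fun_prop) (f := fun q => ((q.1.2, q.1.1), q.2))
    (g := fun q => ((q.1.2, q.1.1), q.2)) (by fun_prop) (by fun_prop) (fun _ => rfl)]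

/-- The two-letter Lagrangian of two independent channel uses is the sum of the Lagrangians. -/
theorem twoLetterLagrangian_of_indep {T₁ T₂ : Ω → τ} {X₁ X₂ : Ω → Fin J → ℝ}
    {Z₁ Z₂ Y₁ Y₂ : Ω → ℝ} (h₁ : IsChannel P K T₁ X₁ Z₁ Y₁) (h₂ : IsChannel P K T₂ X₂ Z₂ Y₂)
    (hind : P.map (fun ω => (((T₁ ω, X₁ ω), Z₁ ω), ((T₂ ω, X₂ ω), Z₂ ω)))
      = (P.map fun ω => ((T₁ ω, X₁ ω), Z₁ ω)).prod (P.map fun ω => ((T₂ ω, X₂ ω), Z₂ ω))) :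
    twoLetterLagrangian 𝒮 lam K P (fun ω => (T₁ ω, T₂ ω)) X₁ X₂ Y₁ Y₂
      = lagrangian 𝒮 lam P T₁ X₁ Y₁ + lagrangian 𝒮 lam P T₂ X₂ Y₂ := by
  have hT₁ := h₁.measurable_T
  have hX₁ := h₁.measurable_X
  have hZ₁ := h₁.measurable_Z
  have hY₁ := h₁.measurable_Y
  have hT₂ := h₂.measurable_T
  have hX₂ := h₂.measurable_X
  have hZ₂ := h₂.measurable_Z
  have hY₂ := h₂.measurable_Y
  have hr : ∀ S : Finset (Fin J), Measurable (S.restrict : (Fin J → ℝ) → S → ℝ) :=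
    fun S => Finset.measurable_restrict S
  have key : ∀ {γ : Type} [MeasurableSpace γ] {f : τ × (Fin J → ℝ) → γ}, Measurable f →
      condRelEntropy P ((gaussianReal 0 1).prod (gaussianReal 0 1))
          (fun ω => (f (T₁ ω, X₁ ω), f (T₂ ω, X₂ ω))) (fun ω => (Y₁ ω, Y₂ ω))
        = condRelEntropy P (gaussianReal 0 1) (fun ω => f (T₁ ω, X₁ ω)) Y₁
          + condRelEntropy P (gaussianReal 0 1) (fun ω => f (T₂ ω, X₂ ω)) Y₂ := by
    intro γ _ f hf
    refine condRelEntropy_of_indep P _ _ (by fun_prop) (by fun_prop) hY₁ hY₂ ?_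
    let F : (τ × (Fin J → ℝ)) × ℝ → γ × ℝ := fun q => (f q.1, (∑ j, q.1.2 j) + q.2)
    have hF : Measurable F := by fun_prop
    have h := congrArg (Measure.map (Prod.map F F)) hind
    rw [Measure.map_map (hF.prodMap hF) (by fun_prop), ← Measure.map_prod_map _ _ hF hF,
      Measure.map_map hF (by fun_prop), Measure.map_map hF (by fun_prop)] at h
    simp only [h₁.output, h₂.output]
    exact h
  rw [h₁.lagrangian_eq, h₂.lagrangian_eq, twoLetterLagrangian,
    key (f := Prod.fst) measurable_fst,
    ENNReal.toReal_add h₁.condRelEntropy_ne_top h₂.condRelEntropy_ne_top]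
  have : ∀ a b x y z k : ℝ, a * x - k * y + (a * z - k * b)
      = a * (x + z) - k * (y + b) := fun a b x y z k => by ring
  rw [this, ← Finset.sum_add_distrib]
  congr 1
  · ring
  · congr 1
    refine Finset.sum_congr rfl fun S _ => ?_
    rw [condRelEntropy_comp_left P _
      (C := fun ω => ((S.restrict (X₁ ω), T₁ ω), (S.restrict (X₂ ω), T₂ ω)))
      (by fun_prop) (by fun_prop) (f := fun q => ((q.1.1, q.2.1), (q.1.2, q.2.2)))
      (g := fun q => ((q.1.1, q.2.1), (q.1.2, q.2.2))) (by fun_prop) (by fun_prop) (fun _ => rfl),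
      key (f := fun q => (S.restrict q.2, q.1)) (by fun_prop),
      ENNReal.toReal_add (h₁.restrict_prodMk S).condRelEntropy_ne_top
        (h₂.restrict_prodMk S).condRelEntropy_ne_top]
    ring

/-- Normalized sums and differences of uncorrelated centered vectors keep the second moments. -/
theorem hasSecondMoment_smul_add {P : Measure Ω} [IsProbabilityMeasure P]
    {K : Matrix (Fin J) (Fin J) ℝ} {X₁ X₂ : Ω → Fin J → ℝ} (hX₁ : Measurable X₁)
    (hX₂ : Measurable X₂) (h₁ : HasSecondMoment (P.map X₁) K) (h₂ : HasSecondMoment (P.map X₂) K)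
    (h₁₂ : ∀ i j, ∫ ω, X₁ ω i * X₂ ω j ∂P = 0) {ε : ℝ} (hε : ε * ε = 1) :
    HasSecondMoment (P.map fun ω => (1 / √2 : ℝ) • (X₁ ω + ε • X₂ ω)) K := by
  have hr : (1 / √2 : ℝ) * (1 / √2) = 1 / 2 := by
    rw [div_mul_div_comm, Real.mul_self_sqrt (by norm_num), one_mul]
  have m₁ : ∀ i, MemLp (fun ω => X₁ ω i) 2 P := fun i =>
    (memLp_map_measure_iff (measurable_pi_apply i).aestronglyMeasurable
      hX₁.aemeasurable).1 (h₁.1 i)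
  have m₂ : ∀ i, MemLp (fun ω => X₂ ω i) 2 P := fun i =>
    (memLp_map_measure_iff (measurable_pi_apply i).aestronglyMeasurable
      hX₂.aemeasurable).1 (h₂.1 i)
  have e₁ : ∀ i j, ∫ ω, X₁ ω i * X₁ ω j ∂P = K i j := fun i j => by
    rw [← h₁.2 i j, integral_map hX₁.aemeasurable (by fun_prop)]
  have e₂ : ∀ i j, ∫ ω, X₂ ω i * X₂ ω j ∂P = K i j := fun i j => by
    rw [← h₂.2 i j, integral_map hX₂.aemeasurable (by fun_prop)]
  have hm : Measurable fun ω => (1 / √2 : ℝ) • (X₁ ω + ε • X₂ ω) := by fun_prop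
  refine ⟨fun i => (memLp_map_measure_iff (measurable_pi_apply i).aestronglyMeasurable
      hm.aemeasurable).2 ?_, fun i j => ?_⟩
  · exact ((m₁ i).add ((m₂ i).const_mul ε)).const_mul (1 / √2)
  · rw [integral_map hm.aemeasurable (by fun_prop)]
    have : ∀ ω, ((1 / √2 : ℝ) • (X₁ ω + ε • X₂ ω)) i * ((1 / √2 : ℝ) • (X₁ ω + ε • X₂ ω)) j
        = 1 / 2 * (X₁ ω i * X₁ ω j + X₂ ω i * X₂ ω j
          + ε * (X₁ ω i * X₂ ω j + X₁ ω j * X₂ ω i)) := fun ω => by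
      simp only [Pi.smul_apply, Pi.add_apply, smul_eq_mul]
      linear_combination (X₁ ω i + ε * X₂ ω i) * (X₁ ω j + ε * X₂ ω j) * hr
        + 1 / 2 * X₂ ω i * X₂ ω j * hε
    have i₁ : Integrable (fun ω => X₁ ω i * X₁ ω j) P := (m₁ i).integrable_mul (m₁ j)
    have i₂ : Integrable (fun ω => X₂ ω i * X₂ ω j) P := (m₂ i).integrable_mul (m₂ j)
    have i₃ : Integrable (fun ω => X₁ ω i * X₂ ω j) P := (m₁ i).integrable_mul (m₂ j)
    have i₄ : Integrable (fun ω => X₁ ω j * X₂ ω i) P := (m₁ j).integrable_mul (m₂ i)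
    simp only [this]
    rw [integral_const_mul, integral_add (by exact i₁.add i₂) (by exact (i₃.add i₄).const_mul ε),
      integral_add i₁ i₂, integral_const_mul, integral_add i₃ i₄, e₁, e₂, h₁₂, h₁₂]
    ring

end TwoLetter

/-! ### Two independent copies of an optimizer -/

theorem attains_rotated_copies (𝒮 : Finpartition (Finset.univ : Finset (Fin J)))
    (hM : 2 ≤ 𝒮.parts.card) (lam : ℝ) (hlam : 0 ≤ lam) (K : Matrix (Fin J) (Fin J) ℝ)
    {τ : Type} [MeasurableSpace τ] (p : Measure (τ × (Fin J → ℝ)))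
    (hp : Attains 𝒮 lam K p) (hmean : ∀ j, ∫ q, q.2 j ∂p = 0)
    {Ω : Type*} [MeasurableSpace Ω] (P : Measure Ω) [IsProbabilityMeasure P]
    {T₁ T₂ : Ω → τ} {X₁ X₂ : Ω → Fin J → ℝ} {Z₁ Z₂ Y₁ Y₂ : Ω → ℝ}
    (hT₁ : Measurable T₁) (hT₂ : Measurable T₂) (hX₁ : Measurable X₁) (hX₂ : Measurable X₂)
    (hZ₁ : Measurable Z₁) (hZ₂ : Measurable Z₂)
    (hlaw : P.map (fun ω => (((T₁ ω, X₁ ω), (T₂ ω, X₂ ω)), (Z₁ ω, Z₂ ω)))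
      = (p.prod p).prod ((gaussianReal 0 1).prod (gaussianReal 0 1)))
    (hY₁ : ∀ ω, Y₁ ω = (∑ j, X₁ ω j) + Z₁ ω) (hY₂ : ∀ ω, Y₂ ω = (∑ j, X₂ ω j) + Z₂ ω)
    {A B : Ω → Fin J → ℝ} {U V : Ω → ℝ}
    (hA : A = fun ω => (1 / √2 : ℝ) • (X₁ ω + X₂ ω))
    (hB : B = fun ω => (1 / √2 : ℝ) • (X₁ ω - X₂ ω))
    (hU : U = fun ω => 1 / √2 * (Y₁ ω + Y₂ ω)) (hV : V = fun ω => 1 / √2 * (Y₁ ω - Y₂ ω)) :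
    Attains 𝒮 lam K (P.map fun ω => ((T₁ ω, T₂ ω), A ω)) ∧
    Attains 𝒮 lam K (P.map fun ω => ((T₁ ω, T₂ ω), B ω)) ∧
    (0 < lam → ∀ S ∈ 𝒮.parts,
      condMutualInfo P U (fun ω => S.restrict (B ω))
        (fun ω => (S.restrict (A ω), (T₁ ω, T₂ ω))) = 0 ∧
      condMutualInfo P V (fun ω => S.restrict (A ω))
        (fun ω => (U ω, S.restrict (B ω), (T₁ ω, T₂ ω))) = 0) := by
  obtain ⟨hprob, hK, hval⟩ := hp
  have hY₁m : Measurable Y₁ := by rw [funext hY₁]; fun_prop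
  have hY₂m : Measurable Y₂ := by rw [funext hY₂]; fun_prop
  set G := gaussianReal 0 1 with hG
  have hpair : P.map (fun ω => (((T₁ ω, X₁ ω), Z₁ ω), ((T₂ ω, X₂ ω), Z₂ ω)))
      = (p.prod G).prod (p.prod G) := by
    rw [← prod_prod_prod_comm_map p p G G, ← hlaw, Measure.map_map (by fun_prop) (by fun_prop)]
    rfl
  have hone : P.map (fun ω => ((T₁ ω, X₁ ω), Z₁ ω)) = p.prod G := by
    have h := congrArg Measure.fst hpair
    rwa [Measure.fst_prod, Measure.fst_map_prodMk (by fun_prop)] at h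
  have htwo : P.map (fun ω => ((T₂ ω, X₂ ω), Z₂ ω)) = p.prod G := by
    have h := congrArg Measure.snd hpair
    rwa [Measure.snd_prod, Measure.snd_map_prodMk (by fun_prop)] at h
  have hone' : P.map (fun ω => (T₁ ω, X₁ ω)) = p := by
    have h := congrArg Measure.fst hone
    rwa [Measure.fst_prod, Measure.fst_map_prodMk (by fun_prop)] at h
  have htwo' : P.map (fun ω => (T₂ ω, X₂ ω)) = p := by
    have h := congrArg Measure.fst htwo
    rwa [Measure.fst_prod, Measure.fst_map_prodMk (by fun_prop)] at h
  have hK₁ : HasSecondMoment (P.map X₁) K := by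
    rw [← hone', Measure.snd_map_prodMk hT₁] at hK; exact hK
  have hK₂ : HasSecondMoment (P.map X₂) K := by
    rw [← htwo', Measure.snd_map_prodMk hT₂] at hK; exact hK
  have ch₁ : IsChannel P K T₁ X₁ Z₁ Y₁ := ⟨hT₁, hX₁, hZ₁, by rw [hone, hone'], hK₁, hY₁⟩
  have ch₂ : IsChannel P K T₂ X₂ Z₂ Y₂ := ⟨hT₂, hX₂, hZ₂, by rw [htwo, htwo'], hK₂, hY₂⟩
  have hinput : P.map (fun ω => ((T₁ ω, X₁ ω), (T₂ ω, X₂ ω))) = p.prod p := by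
    have h := congrArg Measure.fst hlaw
    rwa [Measure.fst_prod, Measure.fst_map_prodMk (by fun_prop)] at h
  -- The only use of the zero mean: independent centered inputs are uncorrelated, so both rotated
  -- inputs keep the second moment `K`.
  have hcross : ∀ i j, ∫ ω, X₁ ω i * X₂ ω j ∂P = 0 := fun i j => by
    have h := integral_prod_mul (μ := p) (ν := p) (fun q => q.2 i) (fun q => q.2 j)
    rw [hmean, zero_mul, ← hinput, integral_map (by fun_prop) (by fun_prop)] at h
    exact h
  have hKA : HasSecondMoment (P.map A) K := by
    have h := hasSecondMoment_smul_add hX₁ hX₂ hK₁ hK₂ hcross (ε := 1) (by norm_num)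
    simpa only [one_smul, ← hA] using h
  have hKB : HasSecondMoment (P.map B) K := by
    have h := hasSecondMoment_smul_add hX₁ hX₂ hK₁ hK₂ hcross (ε := -1) (by norm_num)
    simpa only [neg_smul, one_smul, ← sub_eq_add_neg, ← hB] using h
  have lag : ∀ {T : Ω → τ} {X : Ω → Fin J → ℝ} {Z Y : Ω → ℝ}, IsChannel P K T X Z Y →
      P.map (fun ω => (T ω, X ω)) = p → lagrangian 𝒮 lam P T X Y = lowerS 𝒮 lam p := by
    rintro T X Z Y ch rfl
    exact (ch.lowerS_map_eq 𝒮 lam).symm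
  have hAm : Measurable A := by rw [hA]; fun_prop
  have hBm : Measurable B := by rw [hB]; fun_prop
  have hUm : Measurable U := by rw [hU]; fun_prop
  have hVm : Measurable V := by rw [hV]; fun_prop
  have hlagr : twoLetterLagrangian 𝒮 lam K P (fun ω => (T₁ ω, T₂ ω)) A B U V
      = 2 * lowerS 𝒮 lam p := by
    have h := twoLetterLagrangian_sumDiff 𝒮 lam K P (T := fun ω => (T₁ ω, T₂ ω))
      (by fun_prop) hX₁ hX₂ hY₁m hY₂m
    rw [twoLetterLagrangian_of_indep 𝒮 lam K P ch₁ ch₂ (by rw [hpair, hone, htwo]),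
      lag ch₁ hone', lag ch₂ htwo', ← two_mul] at h
    rw [hA, hB, hU, hV]
    exact h
  have hlagr' := (twoLetterLagrangian_swap 𝒮 lam K P (T := fun ω => (T₁ ω, T₂ ω)) (by fun_prop)
    hAm hBm hUm hVm).trans hlagr
  have hnoise : P.map (fun ω => (((T₁ ω, T₂ ω), A ω, B ω),
        (1 / √2 * (Z₁ ω + Z₂ ω), 1 / √2 * (Z₁ ω - Z₂ ω))))
      = (P.map fun ω => ((T₁ ω, T₂ ω), A ω, B ω)).prod (G.prod G) := by
    have h := congrArg (Measure.map (Prod.map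
      (fun q : (τ × (Fin J → ℝ)) × (τ × (Fin J → ℝ)) => ((q.1.1, q.2.1),
        (1 / √2 : ℝ) • (q.1.2 + q.2.2), (1 / √2 : ℝ) • (q.1.2 - q.2.2)))
      (fun z : ℝ × ℝ => (1 / √2 * (z.1 + z.2), 1 / √2 * (z.1 - z.2))))) hlaw
    rw [Measure.map_map (by fun_prop) (by fun_prop),
      ← Measure.map_prod_map _ _ (by fun_prop) (by fun_prop), gaussianReal_prod_map_rotation,
      ← hinput, Measure.map_map (by fun_prop) (by fun_prop)] at h
    rw [hA, hB]
    exact h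
  have hnoise' : P.map (fun ω => (((T₁ ω, T₂ ω), B ω, A ω),
        (1 / √2 * (Z₁ ω - Z₂ ω), 1 / √2 * (Z₁ ω + Z₂ ω))))
      = (P.map fun ω => ((T₁ ω, T₂ ω), B ω, A ω)).prod (G.prod G) := by
    have h := congrArg (Measure.map (Prod.map
      (fun q : (τ × τ) × (Fin J → ℝ) × (Fin J → ℝ) => (q.1, q.2.2, q.2.1))
      (Prod.swap : ℝ × ℝ → ℝ × ℝ))) hnoise
    rw [Measure.map_map (by fun_prop) (by fun_prop),
      ← Measure.map_prod_map _ _ (by fun_prop) (by fun_prop), Measure.prod_swap,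
      Measure.map_map (by fun_prop) (by fun_prop)] at h
    exact h
  have hUA : ∀ ω, U ω = (∑ j, A ω j) + 1 / √2 * (Z₁ ω + Z₂ ω) := fun ω => by
    simp only [hU, hA, hY₁, hY₂, Pi.smul_apply, Pi.add_apply, smul_eq_mul, ← Finset.mul_sum,
      Finset.sum_add_distrib]
    ring
  have hVB : ∀ ω, V ω = (∑ j, B ω j) + 1 / √2 * (Z₁ ω - Z₂ ω) := fun ω => by
    simp only [hV, hB, hY₁, hY₂, Pi.smul_apply, Pi.sub_apply, smul_eq_mul, ← Finset.mul_sum,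
      Finset.sum_sub_distrib]
    ring
  have main := attains_of_twoLetterLagrangian_eq 𝒮 hM lam hlam K P (by fun_prop) hAm hBm
    (by fun_prop) (by fun_prop) hnoise hKA hKB hUA hVB hval.symm hlagr
  -- With `B` as the first input, the side information is `T` alone; `main` controls `B` only given
  -- `(U, T)`.
  have main' := attains_of_twoLetterLagrangian_eq 𝒮 hM lam hlam K P (by fun_prop) hBm hAm
    (by fun_prop) (by fun_prop) hnoise' hKB hKA hVB hUA hval.symm hlagr'
  exact ⟨main.1, main'.1, main.2⟩

end GMAC

end

theorem lemma1 {J : ℕ} (𝒮 : Finpartition (Finset.univ : Finset (Fin J)))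
    (hM : 2 ≤ 𝒮.parts.card) (lam : ℝ) (hlam : 0 ≤ lam)
    (K : Matrix (Fin J) (Fin J) ℝ) (hK : K.PosSemidef)
    {τ : Type} [MeasurableSpace τ] (p : Measure (τ × (Fin J → ℝ)))
    (hp : GMAC.Attains 𝒮 lam K p) (hmean : ∀ j, ∫ q, q.2 j ∂p = 0)
    {Ω : Type*} [MeasurableSpace Ω] (Pr : Measure Ω) [IsProbabilityMeasure Pr]
    (T₁ T₂ : Ω → τ) (X₁ X₂ : Ω → Fin J → ℝ) (Z₁ Z₂ : Ω → ℝ)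
    (hlaw : HasLaw (fun ω => (((T₁ ω, X₁ ω), (T₂ ω, X₂ ω)), (Z₁ ω, Z₂ ω)))
      ((p.prod p).prod ((gaussianReal 0 1).prod (gaussianReal 0 1))) Pr)
    (Y₁ Y₂ : Ω → ℝ)
    (hY₁ : ∀ ω, Y₁ ω = (∑ j, X₁ ω j) + Z₁ ω) (hY₂ : ∀ ω, Y₂ ω = (∑ j, X₂ ω j) + Z₂ ω)
    (T : Ω → τ × τ) (hT : ∀ ω, T ω = (T₁ ω, T₂ ω))
    (Xθ₁ Xθ₂ : Ω → Fin J → ℝ)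
    (hXθ₁ : ∀ ω, Xθ₁ ω = (1 / √2 : ℝ) • (X₁ ω + X₂ ω))
    (hXθ₂ : ∀ ω, Xθ₂ ω = (1 / √2 : ℝ) • (X₁ ω - X₂ ω))
    (Yθ₁ Yθ₂ : Ω → ℝ)
    (hYθ₁ : ∀ ω, Yθ₁ ω = 1 / √2 * (Y₁ ω + Y₂ ω))
    (hYθ₂ : ∀ ω, Yθ₂ ω = 1 / √2 * (Y₁ ω - Y₂ ω)) :
    GMAC.Attains 𝒮 lam K (Pr.map fun ω => (T ω, Xθ₁ ω)) ∧
    GMAC.Attains 𝒮 lam K (Pr.map fun ω => (T ω, Xθ₂ ω)) ∧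
    (0 < lam → ∀ S ∈ 𝒮.parts,
      GMAC.condMutualInfo Pr Yθ₁ (fun ω => S.restrict (Xθ₂ ω))
        (fun ω => (S.restrict (Xθ₁ ω), T ω)) = 0 ∧
      GMAC.condMutualInfo Pr Yθ₂ (fun ω => S.restrict (Xθ₁ ω))
        (fun ω => (Yθ₁ ω, S.restrict (Xθ₂ ω), T ω)) = 0) := by
  obtain rfl := funext hY₁
  obtain rfl := funext hY₂
  obtain rfl := funext hT
  obtain rfl := funext hXθ₁
  obtain rfl := funext hXθ₂
  obtain rfl := funext hYθ₁
  obtain rfl := funext hYθ₂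
  have hW := hlaw.aemeasurable
  have hr : ∀ S : Finset (Fin J), Measurable (S.restrict : (Fin J → ℝ) → S → ℝ) :=
    fun S => Finset.measurable_restrict S
  have hprob := Measure.isProbabilityMeasure_map hW
  -- `HasLaw` gives only a.e. measurability, so the argument runs on the image space, where the
  -- variables are measurable coordinates.
  have main := GMAC.attains_rotated_copies 𝒮 hM lam hlam K p hp hmean (Pr.map _)
    (T₁ := fun q : ((τ × (Fin J → ℝ)) × (τ × (Fin J → ℝ))) × (ℝ × ℝ) => q.1.1.1)
    (T₂ := fun q => q.1.2.1) (X₁ := fun q => q.1.1.2) (X₂ := fun q => q.1.2.2) (Z₁ := fun q => q.2.1) (Z₂ := fun q => q.2.2)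
    (by fun_prop) (by fun_prop) (by fun_prop) (by fun_prop) (by fun_prop) (by fun_prop)
    (Measure.map_id.trans hlaw.map_eq) (fun _ => rfl) (fun _ => rfl) rfl rfl rfl rfl
  rw [AEMeasurable.map_map_of_aemeasurable (by fun_prop) hW,
    AEMeasurable.map_map_of_aemeasurable (by fun_prop) hW] at main
  refine ⟨main.1, main.2.1, fun hpos S hS => ?_⟩
  obtain ⟨h₁, h₂⟩ := main.2.2 hpos S hS
  rw [← GMAC.condMutualInfo_map Pr _ hW (by fun_prop) (by fun_prop) (by fun_prop)] at h₁ h₂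
  exact ⟨h₁, h₂⟩
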